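/- **Setting.** Fix $c\ge 3$ and $\varepsilon_1,\dots,\varepsilon_c\in\{1,2\}$ with $\varepsilon_1=\varepsilon_c=1$, and let $$w=(+)^{\varepsilon_1}(-)^{\varepsilon_2}(+)^{\varepsilon_3}(-)^{\varepsilon_4}\cdots$$ be the corresponding *reduced billiard table word* (starting with $+$, with $c$ runs of alternating signs) of length $\ell=\sum_i\varepsilon_i$. No condition on $\ell$ modulo $3$ is needed. A *plat* is a word in $\sigma_1^{\pm1},\sigma_2^{\pm1}$ (three strands, drawn from left to right, numbered from bottom to top; $\sigma_i^{+1}$ is a crossing whose overstrand has positive slope, $\sigma_i^{-1}$ one whose overstrand has negative slope) closed up to a long diagram as follows. On the left, strand $1$ is the long end and strands $2,3$ are joined; on the right, either strand $1$ is the long end and strands $2,3$ are joined (bottom exit), or strand $3$ is the long end and strands $1,2$ are joined (top exit). The *billiard table diagram* $\widetilde D$ of $w=w_1\cdots w_\ell$ is the plat $\sigma_1^{w_1}\sigma_2^{w_2}\sigma_1^{w_3}\cdots$ with bottom exit if $\ell$ is odd and top exit if $\ell$ is even. A *rotation at a double* replaces, in a plat, two successive letters $\sigma_i^{s}\sigma_j^{s}$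 with $\{i,j\}=\{1,2\}$ and $s=\pm1$ by the single letter $\sigma_j^{-s}$, keeps everything to the left fixed, and rotates everything to the right, including the right closure, by $180^\circ$ about the horizontal axis (so that $\sigma_1^{\pm1}$ and $\sigma_2^{\pm1}$ are exchanged with unchanged exponents, and the exit changes between bottom and top). Two long diagrams are *isotopic* if they are related by planar isotopies and Reidemeister moves. A diagram is *alternating* if over- and undercrossings alternate along every component. **Theorem.** Let $D$ be the plat with $c$ letters in which the $k$-th run of $w$ contributes the $k$-th letter, by the dictionary $$(+)^1\mapsto\sigma_1,\qquad (+)^2\mapsto\sigma_2^{-1},\qquad (-)^1\mapsto\sigma_2^{-1},\qquad (-)^2\mapsto\sigma_1,$$ with bottom exit if $c$ is odd and top exit if $c$ is even. Then: 1. every rotation at a double, in any plat, yields an isotopic long diagram; 2. $\widetilde D$ is isotopic to $D$; 3. $D$ is obtained from $\widetilde D$ by successive rotations at doubles, exactly one for each $i$ with $\varepsilon_i=2$; 4. $D$ is alternating, and so is the closed diagram obtained by joining its two long ends; 5. $D$ is the unique alternating diagram that can be obtained from $\widetilde D$ by any number of rotations at doubles, in any order. -/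

import Mathlib

/-! Plane diagrams of tangles in sliced (Morse) position, isotopy of tangles through
Reidemeister moves on such diagrams, alternating diagrams, the long knots obtained as plat
closures of words in the three-strand braid generators, and reduced billiard table words. -/

namespace SlicedDiagram

/-- The elementary pieces of a diagram read from left to right: a left turning point `⊂` (`cup`),
a right turning point `⊃` (`cap`), or a crossing. `cross true` (sign `+`) is the crossing whose
overstrand has slope `+1`, i.e. the lower of the two incoming strands passes over;
`cross false` (sign `-`) is the one whose overstrand has slope `-1`. -/
inductive Kind where
  | cup : Kind
  | cap : Kind
  | cross (s : Bool) : Kind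

/-- Number of strands entering the piece from the left. -/
def Kind.inn : Kind → ℕ
  | .cup => 0
  | .cap => 2
  | .cross _ => 2

/-- Number of strands leaving the piece to the right. -/
def Kind.out : Kind → ℕ
  | .cup => 2
  | .cap => 0
  | .cross _ => 2

/-- A vertical slice of a diagram: one elementary piece placed above exactly `pos` parallel
horizontal strands, all other strands of the slice being parallel and horizontal.
Strands are numbered from bottom to top, starting with `0`. -/
structure Slice where
  kind : Kind
  pos : ℕ

/-- `IsTangle m n D`: the list of slices `D`, read from left to right, is the diagram of a tangle
with `m` left endpoints and `n` right endpoints. -/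
inductive IsTangle : ℕ → ℕ → List Slice → Prop
  | nil (n : ℕ) : IsTangle n n []
  | cons (k : Kind) (p q n : ℕ) (D : List Slice) :
      IsTangle (p + k.out + q) n D → IsTangle (p + k.inn + q) n (⟨k, p⟩ :: D)

/-- The local moves: planar isotopies (sliding distant pieces past each other, straightening
a zigzag, sliding a strand over or under a turning point) and the Reidemeister moves I, II, III. -/
inductive LocalMove : List Slice → List Slice → Prop
  | distant (a b : Kind) (i j : ℕ) :
      LocalMove [⟨a, i⟩, ⟨b, i + a.out + j⟩] [⟨b, i + a.inn + j⟩, ⟨a, i⟩]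
  | zigzag_left (i : ℕ) : LocalMove [⟨.cup, i⟩, ⟨.cap, i + 1⟩] []
  | zigzag_right (i : ℕ) : LocalMove [⟨.cup, i + 1⟩, ⟨.cap, i⟩] []
  | slide_cup (s : Bool) (i : ℕ) :
      LocalMove [⟨.cup, i⟩, ⟨.cross s, i + 1⟩] [⟨.cup, i + 1⟩, ⟨.cross (!s), i⟩]
  | slide_cap (s : Bool) (i : ℕ) :
      LocalMove [⟨.cross s, i⟩, ⟨.cap, i + 1⟩] [⟨.cross (!s), i + 1⟩, ⟨.cap, i⟩]
  | reidemeister_one_cup (s : Bool) (i : ℕ) :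
      LocalMove [⟨.cup, i⟩, ⟨.cross s, i⟩] [⟨.cup, i⟩]
  | reidemeister_one_cap (s : Bool) (i : ℕ) :
      LocalMove [⟨.cross s, i⟩, ⟨.cap, i⟩] [⟨.cap, i⟩]
  | reidemeister_two (s : Bool) (i : ℕ) :
      LocalMove [⟨.cross s, i⟩, ⟨.cross (!s), i⟩] []
  | reidemeister_three (s : Bool) (i : ℕ) :
      LocalMove [⟨.cross s, i⟩, ⟨.cross s, i + 1⟩, ⟨.cross s, i⟩]
        [⟨.cross s, i + 1⟩, ⟨.cross s, i⟩, ⟨.cross s, i + 1⟩]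

/-- A local move applied inside a diagram of a tangle with `m` left and `n` right endpoints. -/
def Move (m n : ℕ) (D D' : List Slice) : Prop :=
  IsTangle m n D ∧ IsTangle m n D' ∧
    ∃ u v l r : List Slice, LocalMove l r ∧ D = u ++ l ++ v ∧ D' = u ++ r ++ v

/-- Two tangle diagrams are isotopic if they are related by finitely many planar isotopies and
Reidemeister moves. For `m = n = 1` this is isotopy of long knots and links,
for `m = n = 0` it is isotopy of closed knots and links. -/
def Isotopic (m n : ℕ) (D D' : List Slice) : Prop :=
  IsTangle m n D ∧ IsTangle m n D' ∧ Relation.EqvGen (Move m n) D D'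

/-- The closure of a long diagram (one left and one right endpoint): the two ends are joined by an
arc that runs below the diagram. -/
def closure (D : List Slice) : List Slice :=
  ⟨.cup, 0⟩ :: D.map (fun x => ⟨x.kind, x.pos + 1⟩) ++ [⟨.cap, 0⟩]

/-- The point `(t, j)` is the point of strand `j` on the vertical line between the slices number
`t - 1` and `t`. `Joined D` relates two such points that are the ends of a piece of strand inside
one slice of `D` on which there is no crossing. -/
inductive Joined (D : List Slice) : ℕ × ℕ → ℕ × ℕ → Prop
  | below (t j p : ℕ) (k : Kind) : D[t]? = some ⟨k, p⟩ → j < p → Joined D (t, j) (t + 1, j)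
  | above (t j p : ℕ) (k : Kind) : D[t]? = some ⟨k, p⟩ →
      Joined D (t, p + k.inn + j) (t + 1, p + k.out + j)
  | cup (t p : ℕ) : D[t]? = some ⟨.cup, p⟩ → Joined D (t + 1, p) (t + 1, p + 1)
  | cap (t p : ℕ) : D[t]? = some ⟨.cap, p⟩ → Joined D (t, p) (t, p + 1)

/-- Two points lie on the same arc: the diagram can be followed from one to the other without
going through a crossing. -/
def SameArc (D : List Slice) : ℕ × ℕ → ℕ × ℕ → Prop :=
  Relation.EqvGen (Joined D)

/-- One of the four ends of the crossing in slice number `slice`: on the left or on the right of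
the crossing, lower or upper. -/
structure CrossingEnd where
  slice : ℕ
  right : Bool
  upper : Bool

/-- The point at which an end of a crossing at position `p` is attached. -/
def CrossingEnd.point (e : CrossingEnd) (p : ℕ) : ℕ × ℕ :=
  (e.slice + e.right.toNat, p + e.upper.toNat)

/-- Whether an end of a crossing of sign `s` belongs to the overstrand: for sign `+` these are
the lower left and the upper right end, for sign `-` the upper left and the lower right end. -/
def CrossingEnd.over (e : CrossingEnd) (s : Bool) : Bool :=
  (e.right == e.upper) == s

/-- A diagram is alternating if along every component over- and undercrossings alternate: when two
different crossing ends are joined by an arc, exactly one of them belongs to an overstrand. -/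
def IsAlternating (D : List Slice) : Prop :=
  ∀ (e e' : CrossingEnd) (p p' : ℕ) (s s' : Bool),
    D[e.slice]? = some ⟨.cross s, p⟩ → D[e'.slice]? = some ⟨.cross s', p'⟩ → e ≠ e' →
    SameArc D (e.point p) (e'.point p') → e.over s ≠ e'.over s'

end SlicedDiagram

namespace Billiard

open SlicedDiagram

/-- A letter `σ₁^{±1}` or `σ₂^{±1}` of a word in the generators of the braid group on three strands:
the crossing is between strands `1` and `2` (`low`) or between strands `2` and `3` (not `low`),
counted from the bottom, and `sign` is `true` for the exponent `+1` and `false` for `-1`. -/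
structure Letter where
  low : Bool
  sign : Bool

/-- `σ₁` and `σ₂` are exchanged, with the same exponent: this is the effect on a crossing of a
rotation of three-space by 180 degrees about the horizontal axis in the plane of the diagram. -/
def Letter.flip (x : Letter) : Letter := ⟨!x.low, x.sign⟩

/-- The crossing, as a slice of a three-strand diagram. -/
def Letter.slice (x : Letter) : Slice := ⟨.cross x.sign, if x.low then 0 else 1⟩

/-- A three-strand braid word with a plat closure to a long knot or link. On the left, strand `1` is
the long end and strands `2`, `3` are joined. On the right, either strand `3` is the long end and
strands `1`, `2` are joined (`exitTop = true`), or strand `1` is the long end and strands `2`, `3`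
are joined (`exitTop = false`). -/
structure Plat where
  word : List Letter
  exitTop : Bool

/-- The long diagram of a plat. -/
def Plat.diagram (P : Plat) : List Slice :=
  ⟨.cup, 1⟩ :: P.word.map Letter.slice ++ [⟨.cap, if P.exitTop then 0 else 1⟩]

/-- Rotation at a double: two successive crossings `σᵢ^s σⱼ^s` with `{i, j} = {1, 2}` (one strand
passes over, or under, both other strands) are replaced by the single crossing `σⱼ^{-s}`, while
everything to the left is fixed and everything to the right, including the closure,
is rotated by 180 degrees about the horizontal axis. -/
def Rotates (P Q : Plat) : Prop :=
  ∃ (u v : List Letter) (b s : Bool),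
    P.word = u ++ ⟨b, s⟩ :: ⟨!b, s⟩ :: v ∧
    Q.word = u ++ ⟨!b, !s⟩ :: v.map Letter.flip ∧
    Q.exitTop = !P.exitTop

/-- `Q` is obtained from `P` by exactly `n` successive rotations at doubles. -/
inductive RotatesIn : ℕ → Plat → Plat → Prop
  | refl (P : Plat) : RotatesIn 0 P P
  | step (n : ℕ) (P Q R : Plat) : RotatesIn n P Q → Rotates Q R → RotatesIn (n + 1) P R

/-- The word with successive runs of the lengths `ε`, of alternating signs starting with `s`. -/
def runWord : Bool → List ℕ → List Bool
  | _, [] => []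
  | s, e :: ε => List.replicate e s ++ runWord (!s) ε

/-- The run lengths `ε₁, …, ε_c` of a reduced billiard table word: `c ≥ 3`, `ε₁ = ε_c = 1` and
all `εᵢ ∈ {1, 2}`. -/
def IsReduced (ε : List ℕ) : Prop :=
  3 ≤ ε.length ∧ ε.head? = some 1 ∧ ε.getLast? = some 1 ∧ ∀ e ∈ ε, e = 1 ∨ e = 2

/-- The letters of a billiard table word are the signs of crossings that lie alternately in the lower
and in the upper row. -/
def billiardLetters : Bool → List Bool → List Letter
  | _, [] => []
  | b, s :: w => ⟨b, s⟩ :: billiardLetters (!b) w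

/-- The billiard table diagram of a word `w` of length `n`, on the table of size `3 × (n + 1)`:
the word `σ₁^± σ₂^± σ₁^± ⋯` with the signs `w`. The ball, fired from the lower left corner, leaves
the table in the upper right corner if `n` is even and in the lower right corner if `n` is odd. -/
def billiardPlat (w : List Bool) : Plat :=
  ⟨billiardLetters true w, w.length % 2 == 0⟩

/-- The dictionary: the runs `(+)¹` and `(-)²` become `σ₁`,
the runs `(+)²` and `(-)¹` become `σ₂⁻¹`. -/
def runLetter : Bool → ℕ → Letter
  | true, 1 => ⟨true, true⟩
  | true, _ => ⟨false, false⟩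
  | false, 1 => ⟨false, false⟩
  | false, _ => ⟨true, true⟩

/-- One crossing for each run, by the dictionary; the runs have alternating signs
starting with `s`. -/
def runLetters : Bool → List ℕ → List Letter
  | _, [] => []
  | s, e :: ε => runLetter s e :: runLetters (!s) ε

/-- The diagram of the dictionary for a word starting with `+` with runs of lengths `ε₁, …, ε_c`;
its closure on the right depends on the parity of `c`. -/
def dictionaryPlat (ε : List ℕ) : Plat :=
  ⟨runLetters true ε, ε.length % 2 == 0⟩

end Billiard

namespace SlicedDiagram

/-! ### Calculus of isotopies -/

/-! A half twist Δ satisfies `x` Δ ~ Δ `x.flip`, and the right closure swallows Δ while switching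
between its two forms. At a double, inserting a cancelling pair completes the two letters to Δ;
pushing Δ rightwards out of the diagram flips everything it passes, which is exactly a rotation
(`Rotates.isotopic`).

In the billiard word every run begins with a letter whose row and sign agree. Rotating away a run of
length two flips the remaining word and restores this agreement, so treating the runs from left to
right produces the dictionary.

The dictionary uses only σ₁ and σ₂⁻¹, so the parity of a crossing's height fixes its sign. Orienting
strands by the parity of their height then makes every arc between crossings run from an over-end to
an under-end (`isAlternating_of_parity`).

Uniqueness is a confluence argument: `Resolves` assigns to the billiard word a normal form that no
rotation changes (`Resolves.rotate`). In an alternating plat no double is left, so its word is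
already this normal form; the exit follows by parity. -/

theorem IsTangle.append {m k n : ℕ} {D E : List Slice} (hD : IsTangle m k D)
    (hE : IsTangle k n E) : IsTangle m n (D ++ E) := by
  induction hD with
  | nil _ => exact hE
  | cons k p q n D _ ih => exact .cons k p q _ _ (ih hE)

theorem Isotopic.refl {m n : ℕ} {D : List Slice} (h : IsTangle m n D) : Isotopic m n D D :=
  ⟨h, h, .refl _⟩

theorem Isotopic.symm {m n : ℕ} {D E : List Slice} (h : Isotopic m n D E) : Isotopic m n E D :=
  ⟨h.2.1, h.1, h.2.2.symm⟩

theorem Isotopic.trans {m n : ℕ} {D E F : List Slice} (h : Isotopic m n D E)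
    (h' : Isotopic m n E F) : Isotopic m n D F :=
  ⟨h.1, h'.2.1, h.2.2.trans _ _ _ h'.2.2⟩

theorem LocalMove.isotopic {m n : ℕ} {l r : List Slice} (h : LocalMove l r)
    (hl : IsTangle m n l) (hr : IsTangle m n r) : Isotopic m n l r :=
  ⟨hl, hr, .rel _ _ ⟨hl, hr, [], [], l, r, h, by simp, by simp⟩⟩

theorem Isotopic.context {m k k' n : ℕ} {u v D E : List Slice} (hu : IsTangle m k u)
    (hv : IsTangle k' n v) (h : Isotopic k k' D E) :
    Isotopic m n (u ++ D ++ v) (u ++ E ++ v) := by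
  obtain ⟨hD, hE, h⟩ := h
  refine ⟨(hu.append hD).append hv, (hu.append hE).append hv, ?_⟩
  clear hD hE
  induction h with
  | rel x y hxy =>
    obtain ⟨hx, hy, a, b, l, r, hlr, rfl, rfl⟩ := hxy
    exact .rel _ _ ⟨(hu.append hx).append hv, (hu.append hy).append hv, u ++ a, b ++ v, l, r, hlr,
      by simp, by simp⟩
  | refl x => exact .refl _
  | symm x y _ ih => exact ih.symm
  | trans x y z _ _ ih ih' => exact ih.trans _ _ _ ih'

theorem Isotopic.append_left {m k n : ℕ} {u D E : List Slice} (hu : IsTangle m k u)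
    (h : Isotopic k n D E) : Isotopic m n (u ++ D) (u ++ E) := by
  simpa using h.context hu (.nil n)

theorem Isotopic.append_right {m k n : ℕ} {v D E : List Slice} (h : Isotopic m k D E)
    (hv : IsTangle k n v) : Isotopic m n (D ++ v) (E ++ v) := by
  simpa using h.context (.nil m) hv

/-! ### Diagrams oriented by the parity of strands -/

/-- The neighbour of a point in the slice to its right. -/
def rightNeighbour (D : List Slice) (x : ℕ × ℕ) : Option (ℕ × ℕ) :=
  match D[x.1]? with
  | none => none
  | some ⟨.cup, p⟩ => if x.2 < p then some (x.1 + 1, x.2) else some (x.1 + 1, x.2 + 2)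
  | some ⟨.cap, p⟩ =>
    if x.2 < p then some (x.1 + 1, x.2) else if x.2 = p then some (x.1, p + 1)
    else if x.2 = p + 1 then some (x.1, p) else some (x.1 + 1, x.2 - 2)
  | some ⟨.cross _, p⟩ => if x.2 = p ∨ x.2 = p + 1 then none else some (x.1 + 1, x.2)

/-- The neighbour of a point in the slice to its left. -/
def leftNeighbour (D : List Slice) : ℕ × ℕ → Option (ℕ × ℕ)
  | (0, _) => none
  | (t + 1, j) =>
    match D[t]? with
    | none => none
    | some ⟨.cap, p⟩ => if j < p then some (t, j) else some (t, j + 2)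
    | some ⟨.cup, p⟩ =>
      if j < p then some (t, j) else if j = p then some (t + 1, p + 1)
      else if j = p + 1 then some (t + 1, p) else some (t, j - 2)
    | some ⟨.cross _, p⟩ => if j = p ∨ j = p + 1 then none else some (t, j)

/-- The successor of a point, when strands of even number run to the left and strands of odd
number run to the right, or conversely if `b` is `true`. -/
def next (b : Bool) (D : List Slice) (x : ℕ × ℕ) : Option (ℕ × ℕ) :=
  if (x.2 % 2 == 0) = b then rightNeighbour D x else leftNeighbour D x

/-- The relation of a point to its successor; the predecessor of a point is its successor for
the opposite orientation. -/
def Follows (b : Bool) (D : List Slice) (x y : ℕ × ℕ) : Prop :=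
  next b D x = some y ∧ next (!b) D y = some x

/-- Passing a slice without meeting its piece changes the height by 0 or ±2, and a turning point
joins neighbouring heights. Orientation by parity is therefore consistent along every arc. -/
theorem Joined.follows {D : List Slice} {x y : ℕ × ℕ} (b : Bool) (h : Joined D x y) :
    Follows b D x y ∨ Follows b D y x := by
  have key : ∀ j : ℕ, (j + 1) % 2 = 1 - j % 2 ∧ (j % 2 = 0 ∨ j % 2 = 1) := by omega
  cases h with
  | below t j p k h hj =>
    rcases k with _ | _ | s <;> rcases (key j).2 with e | e <;> cases b <;>
      simp [Follows, next, rightNeighbour, leftNeighbour, h, hj, e] <;> omega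
  | above t j p k h =>
    obtain ⟨h2, h3, h4⟩ : ¬ p + j + 2 < p ∧ p + j + 2 ≠ p ∧ p + j + 1 ≠ p := by omega
    rcases k with _ | _ | s <;> rcases (key (p + j)).2 with e | e <;> cases b <;>
      simp [Follows, next, rightNeighbour, leftNeighbour, h, Kind.inn, Kind.out,
        Nat.add_right_comm p 2 j, e, h2, h3, h4]
  | cup t p h =>
    rcases (key p).2 with e | e <;> cases b <;>
      simp [Follows, next, leftNeighbour, h, e, key p]
  | cap t p h =>
    rcases (key p).2 with e | e <;> cases b <;>
      simp [Follows, next, rightNeighbour, h, e, key p]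

/-- Successors and predecessors are unique, so an arc is a single directed path (or cycle), and of
any two of its points one is reached from the other. -/
theorem SameArc.reachable {D : List Slice} {x y : ℕ × ℕ} (b : Bool) (h : SameArc D x y) :
    Relation.ReflTransGen (Follows b D) x y ∨ Relation.ReflTransGen (Follows b D) y x := by
  induction h with
  | rel x y h => exact (h.follows b).imp .single .single
  | refl x => exact .inl .refl
  | symm x y _ ih => exact ih.symm
  | trans x y z _ _ ih ih' =>
    have right : Relator.RightUnique (Follows b D) := fun x y z h h' =>
      Option.some_injective _ (h.1.symm.trans h'.1)
    have left : Relator.RightUnique (Function.swap (Follows b D)) := fun x y z h h' =>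
      Option.some_injective _ (h.2.symm.trans h'.2)
    rcases ih with h | h <;> rcases ih' with h' | h'
    · exact .inl (h.trans h')
    · have h2 : Relation.ReflTransGen (Function.swap (Follows b D)) x z ∨
          Relation.ReflTransGen (Function.swap (Follows b D)) z x :=
        Relation.ReflTransGen.total_of_right_unique left h.swap h'.swap
      exact h2.symm.imp Relation.reflTransGen_swap.1 Relation.reflTransGen_swap.1
    · exact Relation.ReflTransGen.total_of_right_unique right h h'
    · exact .inr (h'.trans h)

/-- An arc has at most one starting point and at most one end point. -/
theorem SameArc.eq_of_next_eq_none {D : List Slice} {x y : ℕ × ℕ} {b : Bool}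
    (h : SameArc D x y) (hx : next b D x = none) (hy : next b D y = none) : x = y := by
  rcases h.reachable b with h | h
  · rcases h.cases_head with h | ⟨z, h, _⟩
    · exact h
    · exact absurd (hx.symm.trans h.1) (by simp)
  · rcases h.cases_head with h | ⟨z, h, _⟩
    · exact h.symm
    · exact absurd (hy.symm.trans h.1) (by simp)

/-- A diagram whose crossings have signs determined by the parity of their position is
alternating: its arcs, oriented by parity, run from overcrossings to undercrossings. -/
theorem isAlternating_of_parity (b : Bool) {D : List Slice}
    (hD : ∀ s p, ⟨.cross s, p⟩ ∈ D → s = ((p % 2 == 0) != b)) : IsAlternating D := by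
  -- For orientation `b`, under-ends have no successor; over-ends have none for orientation `!b`.
  -- The second part is needed because one point may be both a right end of one crossing and a left
  -- end of the next: height and `over` decide which.
  have key : ∀ (e : CrossingEnd) (p : ℕ) (s : Bool), D[e.slice]? = some ⟨.cross s, p⟩ →
      next (b == !e.over s) D (e.point p) = none ∧
      e.right = (((e.point p).2 % 2 == 0) == (b == e.over s)) := by
    rintro ⟨t, r, u⟩ p s h
    have hs := hD s p (List.mem_of_getElem? h)
    have hp : (p + 1) % 2 = 1 - p % 2 ∧ (p % 2 = 0 ∨ p % 2 = 1) := by omega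
    obtain ⟨hp, e | e⟩ := hp <;> simp only [e] at hs hp <;> cases r <;> cases u <;> cases b <;>
      simp at hs <;> subst hs <;>
      simp_all [next, CrossingEnd.point, CrossingEnd.over, rightNeighbour, leftNeighbour]
  intro e e' p p' s s' h h' hne hsame hover
  obtain ⟨h1, h2⟩ := key e p s h
  obtain ⟨h1', h2'⟩ := key e' p' s' h'
  rw [← hover] at h1' h2'
  have hpt := hsame.eq_of_next_eq_none h1 h1'
  have hr : e.right = e'.right := by rw [h2, h2', hpt]
  rcases e with ⟨t, r, u⟩
  rcases e' with ⟨t', r', u'⟩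
  simp only [CrossingEnd.point, Prod.mk.injEq] at hr hpt h h'
  subst hr
  obtain rfl : t = t' := by omega
  obtain ⟨-, rfl⟩ : Kind.cross s = .cross s' ∧ p = p' := by simpa [h] using h'
  have hu : u.toNat = u'.toNat := by omega
  have hu : u = u' := by revert hu; cases u <;> cases u' <;> simp
  exact hne (by rw [hu])

end SlicedDiagram

namespace Billiard

open SlicedDiagram

/-! ### Rotations at doubles are isotopies -/

/-- The slices of a three-strand word. -/
def slices (w : List Letter) : List Slice := w.map Letter.slice

theorem isTangle_slices (w : List Letter) : IsTangle 3 3 (slices w) := by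
  induction w with
  | nil => exact .nil 3
  | cons x w ih =>
    rcases x with ⟨_ | _, s⟩
    · exact .cons (.cross s) 1 0 3 _ ih
    · exact .cons (.cross s) 0 1 3 _ ih

/-- Isotopy of three-strand words. -/
def BraidIsotopic (w w' : List Letter) : Prop := Isotopic 3 3 (slices w) (slices w')

theorem BraidIsotopic.context {w w' : List Letter} (u v : List Letter)
    (h : BraidIsotopic w w') : BraidIsotopic (u ++ w ++ v) (u ++ w' ++ v) := by
  simpa [BraidIsotopic, slices] using
    Isotopic.context (isTangle_slices u) (isTangle_slices v) h

theorem braidIsotopic_cancel (b s : Bool) : BraidIsotopic [⟨b, s⟩, ⟨b, !s⟩] [] :=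
  LocalMove.isotopic (.reidemeister_two s _) (isTangle_slices _) (isTangle_slices _)

theorem braidIsotopic_braid (b s : Bool) :
    BraidIsotopic [⟨b, s⟩, ⟨!b, s⟩, ⟨b, s⟩] [⟨!b, s⟩, ⟨b, s⟩, ⟨!b, s⟩] := by
  have h : BraidIsotopic [⟨true, s⟩, ⟨false, s⟩, ⟨true, s⟩] [⟨false, s⟩, ⟨true, s⟩, ⟨false, s⟩] :=
    LocalMove.isotopic (.reidemeister_three s 0) (isTangle_slices _) (isTangle_slices _)
  cases b
  · exact h.symm
  · exact h

/-- The half twist, written with first letter `⟨b, s⟩`. -/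
def halfTwist (b s : Bool) : List Letter := [⟨b, s⟩, ⟨!b, s⟩, ⟨b, s⟩]

theorem halfTwist_not (b s : Bool) : BraidIsotopic (halfTwist b s) (halfTwist (!b) s) := by
  simpa [halfTwist] using braidIsotopic_braid b s

theorem halfTwist_eq (b c s : Bool) : BraidIsotopic (halfTwist b s) (halfTwist c s) := by
  rcases eq_or_ne c b with rfl | h
  · exact Isotopic.refl (isTangle_slices _)
  · rw [Bool.eq_not.2 h]
    exact halfTwist_not b s

/-- A crossing moves through a half twist. -/
theorem cons_halfTwist (x : Letter) (b s : Bool) :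
    BraidIsotopic (x :: halfTwist b s) (halfTwist b s ++ [x.flip]) := by
  obtain ⟨c, r⟩ := x
  rcases eq_or_ne r s with rfl | h
  -- Equal signs: start Δ with the other row, so that the four alternating letters can be regrouped
  -- with Δ in front.
  · have h1 := (halfTwist_eq b (!c) r).context [⟨c, r⟩] []
    have h2 := (halfTwist_eq c b r).context [] [⟨!c, r⟩]
    simp only [halfTwist, List.nil_append, List.append_nil, List.cons_append, Bool.not_not] at h1 h2
    exact h1.trans h2
  -- Opposite signs: start Δ with the inverse of the letter, cancel, and create a cancelling pair at
  -- the far end.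
  · obtain rfl : s = !r := Bool.eq_not.2 h.symm
    have h1 := (halfTwist_eq b c (!r)).context [⟨c, r⟩] []
    have h2 := (braidIsotopic_cancel c r).context [] [⟨!c, !r⟩, ⟨c, !r⟩]
    have h3 := (braidIsotopic_cancel (!c) (!r)).context [⟨!c, !r⟩, ⟨c, !r⟩] []
    have h4 := (halfTwist_eq (!c) b (!r)).context [] [⟨!c, r⟩]
    simp only [halfTwist, List.nil_append, List.append_nil, List.cons_append, Bool.not_not]
      at h1 h2 h3 h4
    exact (h1.trans h2).trans (h3.symm.trans h4)

/-- The half twist about the horizontal axis rotates a word. -/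
theorem append_halfTwist (w : List Letter) (b s : Bool) :
    BraidIsotopic (w ++ halfTwist b s) (halfTwist b s ++ w.map Letter.flip) := by
  induction w with
  | nil => exact Isotopic.refl (isTangle_slices _)
  | cons x w ih =>
    have h1 := ih.context [x] []
    have h2 := (cons_halfTwist x b s).context [] (w.map Letter.flip)
    simp only [List.nil_append, List.append_nil, List.cons_append, List.append_assoc] at h1 h2
    exact h1.trans h2

theorem map_flip_flip (w : List Letter) : (w.map Letter.flip).map Letter.flip = w := by
  simp [Function.comp_def, Letter.flip]

/-- The closure of a plat on the right. -/
def exitSlices (e : Bool) : List Slice := [⟨.cap, if e then 0 else 1⟩]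

theorem isTangle_exitSlices (e : Bool) : IsTangle 3 1 (exitSlices e) := by
  cases e
  · exact .cons .cap 1 0 1 _ (.nil 1)
  · exact .cons .cap 0 1 1 _ (.nil 1)

theorem slices_append_exitSlices {w w' : List Letter} (h : BraidIsotopic w w') (e : Bool) :
    Isotopic 3 1 (slices w ++ exitSlices e) (slices w' ++ exitSlices e) :=
  Isotopic.append_right h (isTangle_exitSlices e)

/-- The closure on the right absorbs a half twist and is rotated by it. -/
theorem halfTwist_exitSlices (s e : Bool) :
    Isotopic 3 1 (slices (halfTwist e s) ++ exitSlices e) (exitSlices (!e)) := by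
  -- Of the three letters of Δ, the last is removed by Reidemeister I; sliding the cap turns the
  -- second into the inverse of the first, which then cancels.
  have absorb : Isotopic 3 1 (slices [⟨e, s⟩] ++ exitSlices e) (exitSlices e) :=
    LocalMove.isotopic (.reidemeister_one_cap s _)
      ((isTangle_slices _).append (isTangle_exitSlices e)) (isTangle_exitSlices e)
  have slide : Isotopic 3 1 (slices [⟨!e, s⟩] ++ exitSlices e)
      (slices [⟨e, !s⟩] ++ exitSlices (!e)) := by
    cases e
    · exact LocalMove.isotopic (.slide_cap s 0)
        ((isTangle_slices [⟨true, s⟩]).append (isTangle_exitSlices false))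
        ((isTangle_slices [⟨false, !s⟩]).append (isTangle_exitSlices true))
    · have h := LocalMove.slide_cap (!s) 0
      rw [Bool.not_not] at h
      exact (LocalMove.isotopic h
        ((isTangle_slices [⟨true, !s⟩]).append (isTangle_exitSlices false))
        ((isTangle_slices [⟨false, s⟩]).append (isTangle_exitSlices true))).symm
  have h1 := absorb.append_left (isTangle_slices [⟨e, s⟩, ⟨!e, s⟩])
  have h2 := slide.append_left (isTangle_slices [⟨e, s⟩])
  have h3 := slices_append_exitSlices (braidIsotopic_cancel e s) (!e)
  exact (h1.trans h2).trans h3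

theorem Plat.diagram_eq (P : Plat) :
    P.diagram = [⟨.cup, 1⟩] ++ (slices P.word ++ exitSlices P.exitTop) := rfl

theorem isTangle_diagram (P : Plat) : IsTangle 1 1 P.diagram :=
  .cons .cup 1 0 1 _ ((isTangle_slices P.word).append (isTangle_exitSlices P.exitTop))

/-- A rotation at a double is an isotopy. -/
theorem Rotates.isotopic {P Q : Plat} (h : Rotates P Q) : Isotopic 1 1 P.diagram Q.diagram := by
  obtain ⟨u, v, b, s, hP, hQ, hexit⟩ := h
  rw [Plat.diagram_eq, Plat.diagram_eq, hP, hQ, hexit]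
  refine Isotopic.append_left (k := 3) (.cons .cup 1 0 3 _ (.nil 3)) ?_
  generalize P.exitTop = e
  -- The inserted pair leaves `⟨!b, !s⟩` in place and completes the double to a half twist,
  -- rewritten to begin with `e` to suit the exit.
  have h1 := (braidIsotopic_cancel (!b) (!s)).context u (⟨b, s⟩ :: ⟨!b, s⟩ :: v)
  have h2 := (halfTwist_eq (!b) e s).context (u ++ [⟨!b, !s⟩]) v
  have h3 := (append_halfTwist (v.map Letter.flip) e s).context (u ++ [⟨!b, !s⟩]) []
  rw [map_flip_flip] at h3
  simp only [halfTwist, List.append_nil, List.cons_append, List.append_assoc,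
    List.nil_append, Bool.not_not] at h1 h2 h3
  have h4 := slices_append_exitSlices ((h1.symm.trans h2).trans h3.symm) e
  have h5 := (halfTwist_exitSlices s e).append_left
    (isTangle_slices (u ++ ⟨!b, !s⟩ :: v.map Letter.flip))
  refine h4.trans ?_
  simpa [slices, halfTwist] using h5

theorem RotatesIn.isotopic {n : ℕ} {P Q : Plat} (h : RotatesIn n P Q) :
    Isotopic 1 1 P.diagram Q.diagram := by
  induction h with
  | refl P => exact .refl (isTangle_diagram P)
  | step n P Q R _ hQR ih => exact ih.trans hQR.isotopic

/-! ### From the billiard table diagram to the dictionary -/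

theorem RotatesIn.head {n : ℕ} {P Q R : Plat} (h : Rotates P Q) (h' : RotatesIn n Q R) :
    RotatesIn (n + 1) P R := by
  induction h' with
  | refl Q => exact .step 0 P P Q (.refl P) h
  | step n Q R S _ hRS ih => exact .step (n + 1) P R S (ih h) hRS

theorem map_flip_billiardLetters (b : Bool) (w : List Bool) :
    (billiardLetters b w).map Letter.flip = billiardLetters (!b) w := by
  induction w generalizing b with
  | nil => rfl
  | cons s w ih => simp [billiardLetters, Letter.flip, ih]

/-- The exit of a plat fits the number of its crossings. -/
def ParityExit (P : Plat) : Prop := P.exitTop = (P.word.length % 2 == 0)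

/-- A rotation removes one letter and switches the exit. Hence, among the plats reached from the
billiard plat, the word determines the exit. -/
theorem Rotates.parityExit {P Q : Plat} (h : Rotates P Q) (hP : ParityExit P) :
    ParityExit Q := by
  obtain ⟨u, v, b, s, hPw, hQw, hexit⟩ := h
  rw [ParityExit, hPw] at hP
  rw [ParityExit, hQw, hexit, hP]
  have e : (u ++ ⟨b, s⟩ :: ⟨!b, s⟩ :: v).length =
      (u ++ ⟨!b, !s⟩ :: v.map Letter.flip).length + 1 := by simp; omega
  rw [e]
  generalize (u ++ ⟨!b, !s⟩ :: v.map Letter.flip).length = n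
  rcases Nat.mod_two_eq_zero_or_one n with h | h <;> simp [Nat.add_mod, h]

theorem RotatesIn.parityExit {n : ℕ} {P Q : Plat} (h : RotatesIn n P Q) (hP : ParityExit P) :
    ParityExit Q := by
  induction h with
  | refl P => exact hP
  | step n P Q R _ hQR ih => exact hQR.parityExit (ih hP)

theorem Plat.ext_of_parityExit {P Q : Plat} (h : P.word = Q.word) (hP : ParityExit P)
    (hQ : ParityExit Q) : P = Q := by
  rcases P with ⟨w, e⟩
  rcases Q with ⟨w', e'⟩
  obtain rfl : w = w' := h
  rw [show e = e' from hP.trans hQ.symm]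

theorem length_billiardLetters (b : Bool) (w : List Bool) :
    (billiardLetters b w).length = w.length := by
  induction w generalizing b with
  | nil => rfl
  | cons s w ih => simp [billiardLetters, ih]

theorem length_runLetters (b : Bool) (ε : List ℕ) : (runLetters b ε).length = ε.length := by
  induction ε generalizing b with
  | nil => rfl
  | cons s w ih => simp [runLetters, ih]

theorem parityExit_billiardPlat (w : List Bool) : ParityExit (billiardPlat w) := by
  simp [ParityExit, billiardPlat, length_billiardLetters]

theorem parityExit_dictionaryPlat (ε : List ℕ) : ParityExit (dictionaryPlat ε) := by
  simp [ParityExit, dictionaryPlat, length_runLetters]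

/-- The runs are replaced by the letters of the dictionary one after the other. -/
theorem exists_rotatesIn_runLetters {ε : List ℕ} (hε : ∀ e ∈ ε, e = 1 ∨ e = 2) (b : Bool)
    (u : List Letter) (t : Bool) : ∃ t', RotatesIn (ε.count 2)
      ⟨u ++ billiardLetters b (runWord b ε), t⟩ ⟨u ++ runLetters b ε, t'⟩ := by
  -- The same `b` serves as row and sign of the next run. After a double the remainder would start
  -- in row `b` with sign `!b`; the flip moves it to row `!b`.
  induction ε generalizing b u t with
  | nil => exact ⟨t, .refl _⟩
  | cons e ε ih =>
    have ih := ih fun x hx => hε x (List.mem_cons_of_mem _ hx)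
    rcases hε e List.mem_cons_self with rfl | rfl
    · obtain ⟨t', h⟩ := ih (!b) (u ++ [⟨b, b⟩]) t
      exact ⟨t', by cases b <;>
        simpa [runWord, billiardLetters, runLetters, runLetter] using h⟩
    · obtain ⟨t', h⟩ := ih (!b) (u ++ [⟨!b, !b⟩]) (!t)
      refine ⟨t', ?_⟩
      have hr : Rotates ⟨u ++ billiardLetters b (runWord b (2 :: ε)), t⟩
          ⟨u ++ [⟨!b, !b⟩] ++ billiardLetters (!b) (runWord (!b) ε), !t⟩ :=
        ⟨u, billiardLetters b (runWord (!b) ε), b, b,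
          by simp [runWord, List.replicate, billiardLetters],
          by simp [map_flip_billiardLetters], rfl⟩
      have := RotatesIn.head hr h
      cases b <;> simpa [runLetters, runLetter] using this

theorem rotatesIn_dictionaryPlat {ε : List ℕ} (hε : ∀ e ∈ ε, e = 1 ∨ e = 2) :
    RotatesIn (ε.count 2) (billiardPlat (runWord true ε)) (dictionaryPlat ε) := by
  obtain ⟨t', h⟩ := exists_rotatesIn_runLetters hε true [] ((runWord true ε).length % 2 == 0)
  have e : ⟨[] ++ runLetters true ε, t'⟩ = dictionaryPlat ε :=
    Plat.ext_of_parityExit rfl (h.parityExit (parityExit_billiardPlat _))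
      (parityExit_dictionaryPlat ε)
  exact e ▸ h

/-! ### The diagram of the dictionary is alternating -/

theorem sign_eq_low_of_mem_runLetters {b : Bool} {ε : List ℕ} {x : Letter}
    (hx : x ∈ runLetters b ε) : x.sign = x.low := by
  induction ε generalizing b with
  | nil => simp [runLetters] at hx
  | cons e ε ih =>
    rcases List.mem_cons.1 hx with rfl | hx
    · unfold runLetter
      split <;> rfl
    · exact ih hx

theorem cross_parity_dictionaryPlat {ε : List ℕ} {s : Bool} {p : ℕ}
    (h : ⟨.cross s, p⟩ ∈ (dictionaryPlat ε).diagram) : s = (p % 2 == 0) := by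
  simp only [Plat.diagram, dictionaryPlat, List.cons_append, List.mem_cons, List.mem_append,
    List.mem_map, List.not_mem_nil, or_false] at h
  rcases h with h | ⟨x, hx, h⟩ | h
  · simp at h
  · obtain ⟨rfl, rfl⟩ : x.sign = s ∧ (if x.low then 0 else 1) = p := by
      simpa [Letter.slice] using h
    rw [sign_eq_low_of_mem_runLetters hx]
    cases x.low <;> rfl
  · simp at h

theorem isAlternating_dictionaryPlat (ε : List ℕ) : IsAlternating (dictionaryPlat ε).diagram :=
  isAlternating_of_parity false fun s p h => by simpa using cross_parity_dictionaryPlat h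

theorem isAlternating_closure_dictionaryPlat (ε : List ℕ) :
    IsAlternating (SlicedDiagram.closure (dictionaryPlat ε).diagram) := by
  refine isAlternating_of_parity true fun s p h => ?_
  simp only [SlicedDiagram.closure, List.cons_append, List.mem_cons, List.mem_append,
    List.mem_map, List.not_mem_nil, or_false] at h
  rcases h with h | ⟨⟨k, q⟩, hx, h⟩ | h
  · simp at h
  · obtain ⟨rfl, rfl⟩ : k = .cross s ∧ q + 1 = p := by simpa using h
    rw [cross_parity_dictionaryPlat hx]
    -- The closing arc below raises all crossings by one, which is why the opposite orientation
    -- `true` is used.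
    rcases Nat.mod_two_eq_zero_or_one q with h | h <;> simp [Nat.add_mod, h]
  · simp at h

/-! ### Uniqueness -/

/-- Two letters are compatible if they may be successive in an alternating plat. -/
def Compatible (x y : Letter) : Prop := (x.low == x.sign) = (y.low == y.sign)

/-- Every crossing involves the middle strand, so two successive letters share the middle point
between them; alternation there is compatibility. The index `u.length + 1` accounts for the initial
cup. -/
theorem compatible_of_isAlternating {P : Plat} {u v : List Letter} {x y : Letter}
    (hP : IsAlternating P.diagram) (h : P.word = u ++ x :: y :: v) : Compatible x y := by
  have hx : P.diagram[u.length + 1]? = some x.slice := by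
    simp [Plat.diagram, h]
  have hy : P.diagram[u.length + 1 + 1]? = some y.slice := by
    simp [Plat.diagram, h]
  have := hP ⟨u.length + 1, true, x.low⟩ ⟨u.length + 1 + 1, false, y.low⟩ _ _ _ _ hx hy (by simp)
    (by
      have : CrossingEnd.point ⟨u.length + 1, true, x.low⟩ (if x.low then 0 else 1) =
          CrossingEnd.point ⟨u.length + 1 + 1, false, y.low⟩ (if y.low then 0 else 1) := by
        cases x.low <;> cases y.low <;> rfl
      rw [this]
      exact .refl _)
  rcases x with ⟨_ | _, _ | _⟩ <;> rcases y with ⟨_ | _, _ | _⟩ <;>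
    simp_all [Compatible, CrossingEnd.over]

/-- A rotation at a double, seen on the words alone. -/
inductive WordRotates : List Letter → List Letter → Prop
  | here (b s : Bool) (v : List Letter) :
      WordRotates (⟨b, s⟩ :: ⟨!b, s⟩ :: v) (⟨!b, !s⟩ :: v.map Letter.flip)
  | there (x : Letter) {w w' : List Letter} (h : WordRotates w w') :
      WordRotates (x :: w) (x :: w')

theorem Rotates.wordRotates {P Q : Plat} (h : Rotates P Q) : WordRotates P.word Q.word := by
  obtain ⟨u, v, b, s, hP, hQ, -⟩ := h
  rw [hP, hQ]
  clear hP hQ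
  induction u with
  | nil => exact .here b s v
  | cons x u ih => exact .there x ih

/-- A rotation further left flips the remainder; this lets a later rotation commute with it. -/
theorem WordRotates.map_flip {w w' : List Letter} (h : WordRotates w w') :
    WordRotates (w.map Letter.flip) (w'.map Letter.flip) := by
  induction h with
  | here b s v => simpa [Letter.flip] using WordRotates.here (!b) s (v.map Letter.flip)
  | there x _ ih => exact .there _ ih

/-- `Resolves w w'`: successive letters of `w` are compatible or form a double, no two doubles
overlap, and the rotations at all doubles of `w` yield `w'`. -/
inductive Resolves : List Letter → List Letter → Prop
  | nil : Resolves [] []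
  | single (x : Letter) : Resolves [x] [x]
  | cons {x y : Letter} {v w : List Letter} (hxy : Compatible x y) (h : Resolves (y :: v) w) :
      Resolves (x :: y :: v) (x :: w)
  | double {b s : Bool} {v w : List Letter} (h : Resolves (⟨!b, !s⟩ :: v.map Letter.flip) w) :
      Resolves (⟨b, s⟩ :: ⟨!b, s⟩ :: v) w

theorem not_compatible_double (b s : Bool) : ¬ Compatible ⟨b, s⟩ ⟨!b, s⟩ := by
  cases b <;> cases s <;> simp [Compatible]

/-- Rotations at doubles do not change the word to which a word resolves. -/
theorem Resolves.rotate {w w' r : List Letter} (h : Resolves w r) (hw : WordRotates w w') :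
    Resolves w' r := by
  induction h generalizing w' with
  | nil => cases hw
  | single x =>
    rcases hw with _ | ⟨_, hw⟩
    cases hw
  | @cons x y v w hxy h ih =>
    rcases hw with ⟨b, s, v⟩ | ⟨_, hw⟩
    · exact absurd hxy (not_compatible_double _ _)
    · have := ih hw
      rcases hw with ⟨b, s, v⟩ | ⟨_, hw⟩
      · refine .cons (hxy.trans ?_) this
        cases b <;> cases s <;> rfl
      · exact .cons hxy this
  | @double b s v w h ih =>
    rcases hw with _ | ⟨_, hw⟩
    · exact h
    · generalize hy : (⟨!b, s⟩ : Letter) = y at hw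
      rcases hw with ⟨b', s', v⟩ | ⟨_, hw⟩
      -- Two overlapping doubles: after the first is rotated, `⟨!b, !s⟩` meets `⟨!b, s⟩`, which is
      -- neither a compatible pair nor a double, so `h` is impossible.
      · exfalso
        simp only [Letter.mk.injEq] at hy
        obtain ⟨rfl, rfl⟩ := hy
        simp only [Bool.not_not, List.map_cons, Letter.flip] at h
        generalize hx : (⟨!b, !s⟩ : Letter) = x at h
        generalize hz : (⟨!b, s⟩ : Letter) = z at h
        cases h with
        | cons hxy _ =>
          subst hx hz
          revert hxy
          cases b <;> cases s <;> simp [Compatible]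
        | double _ => cases b <;> cases s <;> simp_all
      · subst hy
        exact .double (ih (.there _ hw.map_flip))

/-- A word with compatible successive letters resolves to itself only. -/
theorem Resolves.eq_of_compatible {w r : List Letter} (h : Resolves w r)
    (hw : ∀ u v x y, w = u ++ x :: y :: v → Compatible x y) : w = r := by
  induction h with
  | nil => rfl
  | single x => rfl
  | @cons x y v w hxy h ih =>
    rw [ih fun u v' x' y' e => hw (x :: u) v' x' y' (by rw [e]; rfl)]
  | @double b s v w h ih => exact absurd (hw [] v _ _ rfl) (not_compatible_double b s)

/-- Once a run is resolved, its letter `⟨c, c⟩` and the next run's first letter `⟨!b, !b⟩` both have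
equal row and sign, hence are compatible; here `c` is `b` or `!b` according to the run length. -/
theorem resolves_billiardLetters {ε : List ℕ} (hε : ∀ e ∈ ε, e = 1 ∨ e = 2) (b : Bool) :
    Resolves (billiardLetters b (runWord b ε)) (runLetters b ε) := by
  induction ε generalizing b with
  | nil => exact .nil
  | cons e ε ih =>
    have ih := ih (fun x hx => hε x (List.mem_cons_of_mem _ hx)) (!b)
    have step : ∀ c : Bool, Resolves (⟨c, c⟩ :: billiardLetters (!b) (runWord (!b) ε))
        (⟨c, c⟩ :: runLetters (!b) ε) := by
      intro c
      rcases ε with _ | ⟨e', ε⟩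
      · exact .single _
      · have he : e' = 1 ∨ e' = 2 := hε e' (by simp)
        rcases he with rfl | rfl <;>
          exact .cons (by cases b <;> cases c <;> rfl) ih
    rcases hε e List.mem_cons_self with rfl | rfl
    · have := step b
      cases b <;> exact this
    · have := step (!b)
      rw [← Bool.not_not b, ← map_flip_billiardLetters, Bool.not_not] at this
      have := Resolves.double this
      cases b <;> exact this

theorem RotatesIn.resolves {n : ℕ} {P Q : Plat} {r : List Letter} (h : RotatesIn n P Q)
    (hP : Resolves P.word r) : Resolves Q.word r := by
  induction h with
  | refl P => exact hP
  | step n P Q R _ hQR ih => exact (ih hP).rotate hQR.wordRotates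

end Billiard

/-- Let `w` be the reduced billiard table word starting with `+` with run lengths `ε`.
(1) Every rotation at a double is an isotopy of long diagrams.
(2) The billiard table diagram of `w` is isotopic to the diagram of the dictionary.
(3) The latter is obtained by rotations, one for each run of length two.
(4) It is alternating, also after its two ends have been joined.
(5) It is the only alternating diagram that arises by rotations at doubles, in any order. -/
theorem mainTheorem5 (ε : List ℕ) (hε : Billiard.IsReduced ε) :
    (∀ P Q : Billiard.Plat, Billiard.Rotates P Q →
      SlicedDiagram.Isotopic 1 1 P.diagram Q.diagram) ∧
    SlicedDiagram.Isotopic 1 1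
      (Billiard.billiardPlat (Billiard.runWord true ε)).diagram
      (Billiard.dictionaryPlat ε).diagram ∧
    Billiard.RotatesIn (ε.count 2)
      (Billiard.billiardPlat (Billiard.runWord true ε)) (Billiard.dictionaryPlat ε) ∧
    SlicedDiagram.IsAlternating (Billiard.dictionaryPlat ε).diagram ∧
    SlicedDiagram.IsAlternating (SlicedDiagram.closure (Billiard.dictionaryPlat ε).diagram) ∧
    (∀ (n : ℕ) (Q : Billiard.Plat),
      Billiard.RotatesIn n (Billiard.billiardPlat (Billiard.runWord true ε)) Q →
      SlicedDiagram.IsAlternating Q.diagram → Q = Billiard.dictionaryPlat ε) := by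
  have h12 := hε.2.2.2
  have hrot := Billiard.rotatesIn_dictionaryPlat h12
  refine ⟨fun P Q h => h.isotopic, hrot.isotopic, hrot, Billiard.isAlternating_dictionaryPlat ε,
    Billiard.isAlternating_closure_dictionaryPlat ε, fun n Q hQ halt => ?_⟩
  refine Billiard.Plat.ext_of_parityExit ?_ (hQ.parityExit (Billiard.parityExit_billiardPlat _))
    (Billiard.parityExit_dictionaryPlat ε)
  exact (hQ.resolves (Billiard.resolves_billiardLetters h12 true)).eq_of_compatible
    fun u v x y h => Billiard.compatible_of_isAlternating halt h
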